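/- Work over $\mathbb{C}$. Let $X\subset\mathbb{P}^N$ be an integral nondegenerate projective variety with smooth locus $X_{\mathrm{reg}}$, and let $\mathcal{S}_r(X)$ be the set of subsets of $X_{\mathrm{reg}}$ consisting of $r$ distinct points. For $A\in\mathcal{S}_r(X)$ let $\langle 2A\rangle\subseteq\mathbb{P}^N$ be the linear span of the union of the embedded tangent spaces $T_aX$, $a\in A$, and set $$B(A)=\langle 2A\rangle\cap (X_{\mathrm{reg}}\setminus A)$$ (as a set), and $$\mathcal{B}_r(X)=\{A\in\mathcal{S}_r(X) : \langle 2A\rangle\neq\mathbb{P}^N \text{ and } B(A)\neq\emptyset\}.$$ For integers $n,d\ge 1$ let $\nu_d:\mathbb{P}^n\to\mathbb{P}^N$, $N=\binom{n+d}{d}-1$, be the Veronese embedding given by all monomials of degree $d$, and let $V_n^d=\nu_d(\mathbb{P}^n)$. **Theorem.** Let $n\ge 2$ and $d\ge 2$ be integers. 1. For every integer $r\ge 0$, $\mathcal{B}_r(V_n^d)\neq\emptyset$ if and only if $2r\ge d+1$. 2. Let $\lceil (d+1)/2\rceil\le r\le d$ and let $A\subset\mathbb{P}^n$ be a set of $r$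 points with $\nu_d(A)\in\mathcal{B}_r(V_n^d)$. * (a) If $r=d\ge 5$ and $d$ is odd, then either there is a line $L\subset\mathbb{P}^n$ containing at least $(d+1)/2$ points of $A$ such that $B(\nu_d(A))=\nu_d(L\setminus A)$, or there are two distinct lines $L,R\subset\mathbb{P}^n$ which meet in exactly one point, that point belonging to $A$, each containing exactly $(d+1)/2$ points of $A$, such that $B(\nu_d(A))=\nu_d((L\cup R)\setminus A)$. * (b) If $r<d$, or if $r=d$ and $d$ is even, then there is a line $L\subset\mathbb{P}^n$ containing at least $\lceil (d+1)/2\rceil$ points of $A$ such that $B(\nu_d(A))=\nu_d(L\setminus A)$. 3. If $d=3$, then $\mathcal{B}_3(V_n^3)=\mathcal{S}_3(V_n^3)$. Moreover, let $A\subset\mathbb{P}^n$ be a set of three points. If $A$ is not contained in a line, then there are three distinct lines $L,R,T\subset\mathbb{P}^n$, each containing exactly two points of $A$, such that $B(\nu_3(A))\cup\nu_3(A)=\nu_3(L\cup R\cup T)$. If $A$ is contained in a line $L$, then $B(\nu_3(A))=\nu_3(L\setminus A)$. -/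

import Mathlib

open scoped LinearAlgebra.Projectivization

noncomputable section

namespace BaseLocus

/-- A homogeneous form `F` vanishes on the subset `X` of projective space. Vanishing of a
homogeneous polynomial at a point does not depend on the chosen representative. -/
def VanishesOn {σ : Type*} (X : Set (ℙ ℂ (σ → ℂ))) (F : MvPolynomial σ ℂ) : Prop :=
  ∀ q ∈ X, MvPolynomial.eval q.rep F = 0

/-- The embedded (projective) tangent space of `X` at `p`, as a linear subspace of the ambient
vector space: the common zeros of the differentials at `p` of all the homogeneous forms that vanish
on `X`. Its projectivization is the usual embedded tangent space `T_p X`. -/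
def tangentSpace {σ : Type*} [Fintype σ] (X : Set (ℙ ℂ (σ → ℂ))) (p : ℙ ℂ (σ → ℂ)) :
    Submodule ℂ (σ → ℂ) where
  carrier := {w | ∀ (k : ℕ) (F : MvPolynomial σ ℂ), F.IsHomogeneous k → VanishesOn X F →
    ∑ i, MvPolynomial.eval p.rep (MvPolynomial.pderiv i F) * w i = 0}
  zero_mem' := by intro k F _ _; simp
  add_mem' := by
    intro v w hv hw k F hF hX
    simp only [Pi.add_apply, mul_add, Finset.sum_add_distrib, hv k F hF hX, hw k F hF hX, add_zero]
  smul_mem' := by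
    intro c w hw k F hF hX
    have h := hw k F hF hX
    simp only [Pi.smul_apply, smul_eq_mul, mul_left_comm _ c, ← Finset.mul_sum, h, mul_zero]

/-- The smooth locus `X_reg` of an irreducible projective variety `X`: the points at which the
embedded tangent space has the smallest dimension that occurs on `X` (for an irreducible variety
this smallest dimension is `dim X`). -/
def regularLocus {σ : Type*} [Fintype σ] (X : Set (ℙ ℂ (σ → ℂ))) : Set (ℙ ℂ (σ → ℂ)) :=
  {p | p ∈ X ∧ ∀ q ∈ X,
    Module.finrank ℂ (tangentSpace X p) ≤ Module.finrank ℂ (tangentSpace X q)}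

/-- `S_r(X)`: the sets of `r` distinct smooth points of `X`. -/
def smoothSets {σ : Type*} [Fintype σ] (r : ℕ) (X : Set (ℙ ℂ (σ → ℂ))) :
    Set (Set (ℙ ℂ (σ → ℂ))) :=
  {A | A ⊆ regularLocus X ∧ A.encard = r}

/-- The linear span `⟨2A⟩` of the union of the tangent spaces of `X` at the points of `A`, as a
linear subspace of the ambient vector space. -/
def tangentSpan {σ : Type*} [Fintype σ] (X A : Set (ℙ ℂ (σ → ℂ))) : Submodule ℂ (σ → ℂ) :=
  ⨆ a ∈ A, tangentSpace X a

/-- `B(A)`: the smooth points of `X` outside `A` that lie in `⟨2A⟩`. -/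
def extraPoints {σ : Type*} [Fintype σ] (X A : Set (ℙ ℂ (σ → ℂ))) : Set (ℙ ℂ (σ → ℂ)) :=
  {q | q ∈ regularLocus X \ A ∧ q.submodule ≤ tangentSpan X A}

/-- The `r`-th base locus `B_r(X)` of `X`: the sets `A` of `r` smooth points such that `⟨2A⟩` is
not the whole ambient space and contains a smooth point of `X` outside `A`. -/
def baseLocus {σ : Type*} [Fintype σ] (r : ℕ) (X : Set (ℙ ℂ (σ → ℂ))) :
    Set (Set (ℙ ℂ (σ → ℂ))) :=
  {A | A ∈ smoothSets r X ∧ tangentSpan X A ≠ ⊤ ∧ (extraPoints X A).Nonempty}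

/-- A subset of projective space that is a line, i.e. the projectivization of a linear subspace of
dimension two. -/
def IsLine {V : Type*} [AddCommGroup V] [Module ℂ V] (L : Set (ℙ ℂ V)) : Prop :=
  ∃ W : Submodule ℂ V, Module.finrank ℂ W = 2 ∧ L = {p | p.submodule ≤ W}

/-- The exponent vectors of the monomials of degree `d` in `n + 1` variables; they index the
homogeneous coordinates of the target of the Veronese embedding. -/
abbrev Exponents (n d : ℕ) : Type := Finset.Nat.antidiagonalTuple (n + 1) d

/-- The affine Veronese map, `x ↦ (x ^ α)` over all the exponents `α` of degree `d`. -/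
def veroneseVec (n d : ℕ) (x : Fin (n + 1) → ℂ) : Exponents n d → ℂ :=
  fun α => ∏ i, x i ^ (α : Fin (n + 1) → ℕ) i

theorem veroneseVec_ne_zero (n d : ℕ) {x : Fin (n + 1) → ℂ} (hx : x ≠ 0) :
    veroneseVec n d x ≠ 0 := by
  obtain ⟨i, hi⟩ := Function.ne_iff.mp hx
  have hmem : (Pi.single i d : Fin (n + 1) → ℕ) ∈ Finset.Nat.antidiagonalTuple (n + 1) d := by
    rw [Finset.Nat.mem_antidiagonalTuple]
    simp
  intro h
  have h0 := congrFun h ⟨Pi.single i d, hmem⟩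
  rw [veroneseVec, Pi.zero_apply, Finset.prod_eq_single i] at h0
  · exact pow_ne_zero _ hi h0
  · intro j _ hj
    simp [hj]
  · simp

theorem veroneseVec_smul (n d : ℕ) (t : ℂ) (x : Fin (n + 1) → ℂ) :
    veroneseVec n d (t • x) = t ^ d • veroneseVec n d x := by
  funext α
  have hα := Finset.Nat.mem_antidiagonalTuple.mp α.2
  simp only [veroneseVec, Pi.smul_apply, smul_eq_mul, mul_pow, Finset.prod_mul_distrib,
    Finset.prod_pow_eq_pow_sum, hα]

/-- The `d`-th Veronese embedding `ν_d` of `ℙⁿ`, given by all the monomials of degree `d`. -/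
def veronese (n d : ℕ) : ℙ ℂ (Fin (n + 1) → ℂ) → ℙ ℂ (Exponents n d → ℂ) :=
  Projectivization.lift
    (fun v => Projectivization.mk ℂ (veroneseVec n d v.1) (veroneseVec_ne_zero n d v.2))
    (by
      intro a b t h
      refine (Projectivization.mk_eq_mk_iff' ℂ _ _ _ _).mpr ⟨t ^ d, ?_⟩
      rw [← veroneseVec_smul, ← h])

/-- The Veronese variety `V_n^d = ν_d(ℙⁿ)`. -/
def veroneseVariety (n d : ℕ) : Set (ℙ ℂ (Exponents n d → ℂ)) :=
  Set.range (veronese n d)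

end BaseLocus

end

/-! The theorem reduces to one computation about forms of degree `d`. The tangent space of the
Veronese variety is the image of the differential of the affine Veronese map
(`tangentSpace_veronese`), so the hyperplanes containing `⟨2A⟩` are exactly the nonzero degree `d`
forms singular along `A`. Hence `ν_d(b) ∈ ⟨2A⟩` if and only if all these forms vanish at `b`, that
is, `b ∈ singularBase d A`.

For at most `d` points this base is, outside `A`, the union of the heavy lines, those carrying more
than `d / 2` points of `A` (`singularBase_diff_eq`). On a heavy line a form singular along `A` has
too many double roots and vanishes identically (`line_subset_singularBase`). Conversely, if no heavy
line passes through `b ∉ A`, the doubled points of `A` can be distributed over `d` hyperplanes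
avoiding `b`; the product of their equations is singular along `A` and nonzero at `b`
(`notMem_singularBase`).

What remains is counting: distinct lines share at most one point, so two heavy lines need at least
`2⌈(d+1)/2⌉ - 1` points. This excludes a second heavy line when `r < d` or `r = d` is even, excludes
a third when `r = d ≥ 5` is odd, and leaves the triangle for `d = 3`. -/

noncomputable section

namespace BaseLocus

open MvPolynomial Module

/-! ### Differentials of polynomial functions -/

section Differential

variable {σ τ : Type*}

theorem eval_eval_aeval (g : σ → Polynomial ℂ) (F : MvPolynomial σ ℂ) (t : ℂ) :
    (aeval g F).eval t = eval (fun i => (g i).eval t) F := by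
  induction F using MvPolynomial.induction_on with
  | C c => simp
  | add F G hF hG => simp [hF, hG]
  | mul_X F i hF => simp [hF]

theorem IsHomogeneous.eval_smul {F : MvPolynomial σ ℂ} {k : ℕ} (hF : F.IsHomogeneous k) (t : ℂ)
    (x : σ → ℂ) : eval (t • x) F = t ^ k * eval x F := by
  rw [eval_eq, eval_eq, Finset.mul_sum]
  refine Finset.sum_congr rfl fun m hm => ?_
  have hk : m.degree = k := by
    rw [Finsupp.degree_eq_weight_one]
    exact hF (mem_support_iff.mp hm)
  simp only [Pi.smul_apply, smul_eq_mul, mul_pow, Finset.prod_mul_distrib,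
    Finset.prod_pow_eq_pow_sum]
  rw [show ∑ i ∈ m.support, m i = k from hk]
  ring

variable [Fintype σ] [Fintype τ]

/-- The differential at `x` of the polynomial function `F`. -/
def differential (F : MvPolynomial σ ℂ) (x : σ → ℂ) : (σ → ℂ) →ₗ[ℂ] ℂ :=
  ∑ i, eval x (pderiv i F) • LinearMap.proj i

theorem differential_apply (F : MvPolynomial σ ℂ) (x v : σ → ℂ) :
    differential F x v = ∑ i, eval x (pderiv i F) * v i := by
  simp [differential]

theorem differential_C (c : ℂ) (x v : σ → ℂ) : differential (C c) x v = 0 := by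
  simp [differential_apply]

theorem differential_X (i : σ) (x v : σ → ℂ) : differential (X i) x v = v i := by
  classical
  simp only [differential_apply, pderiv_X]
  rw [Finset.sum_eq_single i] <;> simp +contextual [eq_comm]

theorem differential_add (F G : MvPolynomial σ ℂ) (x v : σ → ℂ) :
    differential (F + G) x v = differential F x v + differential G x v := by
  simp [differential_apply, add_mul, Finset.sum_add_distrib]

theorem differential_sub (F G : MvPolynomial σ ℂ) (x v : σ → ℂ) :
    differential (F - G) x v = differential F x v - differential G x v := by
  simp [differential_apply, sub_mul, Finset.sum_sub_distrib]

theorem differential_mul (F G : MvPolynomial σ ℂ) (x v : σ → ℂ) :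
    differential (F * G) x v =
      eval x F * differential G x v + eval x G * differential F x v := by
  simp only [differential_apply, Finset.mul_sum, ← Finset.sum_add_distrib]
  refine Finset.sum_congr rfl fun i _ => ?_
  simp only [pderiv_mul, map_add, map_mul]
  ring

theorem differential_C_mul (c : ℂ) (F : MvPolynomial σ ℂ) (x v : σ → ℂ) :
    differential (C c * F) x v = c * differential F x v := by
  simp [differential_mul, differential_C]

theorem differential_sum {ι : Type*} (s : Finset ι) (F : ι → MvPolynomial σ ℂ) (x v : σ → ℂ) :
    differential (∑ i ∈ s, F i) x v = ∑ i ∈ s, differential (F i) x v := by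
  simp only [differential_apply, map_sum, Finset.sum_mul]
  exact Finset.sum_comm

theorem differential_pow (F : MvPolynomial σ ℂ) (k : ℕ) (x v : σ → ℂ) :
    differential (F ^ k) x v = k * eval x F ^ (k - 1) * differential F x v := by
  simp only [differential_apply, pderiv_pow, Finset.mul_sum, map_mul, map_pow, map_natCast]
  exact Finset.sum_congr rfl fun i _ => by ring

theorem differential_prod_eq_zero {ι : Type*} (s : Finset ι) (F : ι → MvPolynomial σ ℂ)
    (x v : σ → ℂ) (h : ∀ i ∈ s, differential (F i) x v = 0) :
    differential (∏ i ∈ s, F i) x v = 0 := by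
  classical
  induction s using Finset.induction_on with
  | empty => simpa using differential_C 1 x v
  | insert a s ha ih =>
    rw [Finset.prod_insert ha, differential_mul, h a (by simp),
      ih fun i hi => h i (by simp [hi])]
    simp

theorem differential_aeval (g : τ → MvPolynomial σ ℂ) (F : MvPolynomial τ ℂ) (x v : σ → ℂ) :
    differential (aeval g F) x v =
      differential F (fun i => eval x (g i)) (fun i => differential (g i) x v) := by
  induction F using MvPolynomial.induction_on with
  | C c =>
    rw [aeval_C, algebraMap_eq, differential_C, differential_C]
  | add F G hF hG => rw [map_add, differential_add, differential_add, hF, hG]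
  | mul_X F i hF =>
    have h : eval x (aeval g F) = eval (fun i => eval x (g i)) F := by
      simp only [aeval_eq_bind₁, ← coe_aeval_eq_eval, RingHom.coe_coe, aeval_bind₁]
    rw [map_mul, aeval_X, differential_mul, differential_mul, hF, differential_X, eval_X, h]

theorem eval_derivative_aeval (g : σ → Polynomial ℂ) (F : MvPolynomial σ ℂ) (t : ℂ) :
    (aeval g F).derivative.eval t =
      differential F (fun i => (g i).eval t) (fun i => (g i).derivative.eval t) := by
  induction F using MvPolynomial.induction_on with
  | C c =>
    rw [aeval_C, differential_C]
    simp
  | add F G hF hG => rw [map_add, differential_add, ← hF, ← hG]; simp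
  | mul_X F i hF =>
    rw [map_mul, aeval_X, differential_mul, ← hF, differential_X, eval_X, ← eval_eval_aeval,
      Polynomial.derivative_mul]
    simp
    ring

theorem differential_smul_left {F : MvPolynomial σ ℂ} {k : ℕ} (hF : F.IsHomogeneous k) (t : ℂ)
    (x v : σ → ℂ) : differential F (t • x) v = t ^ (k - 1) * differential F x v := by
  simp only [differential_apply, Finset.mul_sum, IsHomogeneous.eval_smul hF.pderiv, mul_assoc]

theorem IsHomogeneous.differential_self {F : MvPolynomial σ ℂ} {k : ℕ} (hF : F.IsHomogeneous k)
    (x : σ → ℂ) : differential F x x = k * eval x F := by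
  have h := congrArg (eval x) hF.sum_X_mul_pderiv
  simp only [map_sum, map_mul, eval_X, nsmul_eq_mul, map_natCast] at h
  rw [← h, differential_apply]
  exact Finset.sum_congr rfl fun i _ => mul_comm _ _

/-- The linear form attached to a linear functional. -/
def linearForm (l : Dual ℂ (σ → ℂ)) : MvPolynomial σ ℂ := by
  classical exact ∑ i, C (l (Pi.single i 1)) * X i

theorem eval_linearForm (l : Dual ℂ (σ → ℂ)) (x : σ → ℂ) : eval x (linearForm l) = l x := by
  classical
  conv_rhs => rw [← LinearMap.sum_single_apply (fun _ => ℂ) x]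
  simp only [linearForm, map_sum, map_mul, eval_C, eval_X]
  refine Finset.sum_congr rfl fun i _ => ?_
  rw [mul_comm, ← smul_eq_mul, ← map_smul]
  congr 1
  ext j
  simp [Pi.single_apply]

theorem isHomogeneous_linearForm (l : Dual ℂ (σ → ℂ)) : (linearForm l).IsHomogeneous 1 :=
  IsHomogeneous.sum _ _ _ fun i _ => by
    simpa using (isHomogeneous_C σ _).mul (isHomogeneous_X ℂ i)

theorem differential_mul_mul_eq_zero {F G H : MvPolynomial σ ℂ} {x : σ → ℂ} (hF : eval x F = 0)
    (hG : eval x G = 0) (v : σ → ℂ) : differential (F * (G * H)) x v = 0 := by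
  simp [differential_mul, hF, hG]

end Differential

/-! ### The Veronese variety and its tangent spaces -/

section Veronese

variable {n d : ℕ}

/-- The monomial with a given exponent vector. -/
def exponentMonomial (α : Exponents n d) : MvPolynomial (Fin (n + 1)) ℂ :=
  ∏ i, X i ^ (α : Fin (n + 1) → ℕ) i

theorem eval_exponentMonomial (α : Exponents n d) (x : Fin (n + 1) → ℂ) :
    eval x (exponentMonomial α) = veroneseVec n d x α := by
  simp [exponentMonomial, veroneseVec]

theorem exponentMonomial_eq (α : Exponents n d) :
    exponentMonomial α = monomial (Finsupp.equivFunOnFinite.symm (α : Fin (n + 1) → ℕ)) 1 := by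
  rw [monomial_eq, Finsupp.prod_fintype _ _ (by simp)]
  simp [exponentMonomial]

theorem isHomogeneous_exponentMonomial (α : Exponents n d) :
    (exponentMonomial α).IsHomogeneous d := by
  rw [exponentMonomial_eq]
  refine isHomogeneous_monomial _ ?_
  rw [Finsupp.degree_eq_sum]
  simpa using Finset.Nat.mem_antidiagonalTuple.mp α.2

/-- The form of degree `d` with a given vector of coefficients. -/
def formOf (c : Exponents n d → ℂ) : MvPolynomial (Fin (n + 1)) ℂ :=
  ∑ α, C (c α) * exponentMonomial α

theorem isHomogeneous_formOf (c : Exponents n d → ℂ) : (formOf c).IsHomogeneous d :=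
  IsHomogeneous.sum _ _ _ fun α _ => by
    simpa using (isHomogeneous_C _ _).mul (isHomogeneous_exponentMonomial α)

theorem eval_formOf (c : Exponents n d → ℂ) (x : Fin (n + 1) → ℂ) :
    eval x (formOf c) = ∑ α, c α * veroneseVec n d x α := by
  simp [formOf, eval_exponentMonomial]

theorem exists_formOf_eq {F : MvPolynomial (Fin (n + 1)) ℂ} (hF : F.IsHomogeneous d) :
    ∃ c : Exponents n d → ℂ, formOf c = F := by
  refine ⟨fun α => coeff (Finsupp.equivFunOnFinite.symm (α : Fin (n + 1) → ℕ)) F, ?_⟩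
  ext m
  simp only [formOf, coeff_sum, coeff_C_mul, exponentMonomial_eq, coeff_monomial]
  by_cases hm : m.degree = d
  · have hmem : (m : Fin (n + 1) → ℕ) ∈ Finset.Nat.antidiagonalTuple (n + 1) d := by
      rw [Finset.Nat.mem_antidiagonalTuple, ← hm, Finsupp.degree_eq_sum]
    rw [Finset.sum_eq_single ⟨m, hmem⟩]
    · simp
    · intro β _ hβ
      rw [if_neg, mul_zero]
      rintro rfl
      exact hβ (by ext; simp)
    · simp
  · rw [hF.coeff_eq_zero hm]
    refine Finset.sum_eq_zero fun β _ => ?_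
    rw [if_neg, mul_zero]
    rintro rfl
    apply hm
    rw [Finsupp.degree_eq_sum]
    simpa using Finset.Nat.mem_antidiagonalTuple.mp β.2

variable (n d) in
/-- The differential at `x` of the affine Veronese map. -/
def veroneseDifferential (x : Fin (n + 1) → ℂ) : (Fin (n + 1) → ℂ) →ₗ[ℂ] (Exponents n d → ℂ) :=
  LinearMap.pi fun α => differential (exponentMonomial α) x

theorem veroneseDifferential_apply (x v : Fin (n + 1) → ℂ) (α : Exponents n d) :
    veroneseDifferential n d x v α = differential (exponentMonomial α) x v := rfl

theorem differential_formOf (c : Exponents n d → ℂ) (x v : Fin (n + 1) → ℂ) :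
    differential (formOf c) x v = ∑ α, c α * veroneseDifferential n d x v α := by
  simp [formOf, differential_sum, differential_C_mul, veroneseDifferential_apply]

theorem veronese_mk {x : Fin (n + 1) → ℂ} (hx : x ≠ 0) :
    veronese n d (Projectivization.mk ℂ x hx) =
      Projectivization.mk ℂ (veroneseVec n d x) (veroneseVec_ne_zero n d hx) := rfl

theorem veronese_submodule (p : ℙ ℂ (Fin (n + 1) → ℂ)) :
    (veronese n d p).submodule = Submodule.span ℂ {veroneseVec n d p.rep} := by
  conv_lhs => rw [← p.mk_rep, veronese_mk, Projectivization.submodule_mk]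

/-- The scalar relating the chosen representative to a Veronese vector has a `d`-th root over `ℂ`,
which can be absorbed into the argument. -/
theorem exists_smul_veroneseVec_eq_rep (hd : d ≠ 0) (p : ℙ ℂ (Fin (n + 1) → ℂ)) :
    ∃ t : ℂ, t ≠ 0 ∧ (veronese n d p).rep = veroneseVec n d (t • p.rep) := by
  obtain ⟨a, ha⟩ := Projectivization.exists_smul_eq_mk_rep ℂ (veroneseVec n d p.rep)
    (veroneseVec_ne_zero n d p.rep_nonzero)
  rw [← veronese_mk p.rep_nonzero, p.mk_rep] at ha
  obtain ⟨t, ht⟩ := IsAlgClosed.exists_pow_nat_eq (a : ℂ) (Nat.pos_of_ne_zero hd)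
  refine ⟨t, ?_, ?_⟩
  · rintro rfl
    rw [zero_pow hd] at ht
    exact a.ne_zero ht.symm
  · rw [← ha, veroneseVec_smul, ht]
    rfl

/-- The exponent vector of `x_j ^ (d - 1) * x_i`. -/
def coordExponent (hd : d ≠ 0) (j i : Fin (n + 1)) : Exponents n d :=
  ⟨fun k => (if k = j then d - 1 else 0) + if k = i then 1 else 0, by
    rw [Finset.Nat.mem_antidiagonalTuple, Finset.sum_add_distrib]
    simp
    omega⟩

theorem exponentMonomial_coordExponent (hd : d ≠ 0) (j i : Fin (n + 1)) :
    exponentMonomial (coordExponent hd j i) = X j ^ (d - 1) * X i := by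
  simp only [exponentMonomial, coordExponent, pow_add, Finset.prod_mul_distrib]
  simp [pow_ite]

theorem veroneseVec_coordExponent (hd : d ≠ 0) (j i : Fin (n + 1)) (x : Fin (n + 1) → ℂ) :
    veroneseVec n d x (coordExponent hd j i) = x j ^ (d - 1) * x i := by
  rw [← eval_exponentMonomial, exponentMonomial_coordExponent]
  simp

theorem veroneseDifferential_coordExponent (hd : d ≠ 0) (j i : Fin (n + 1))
    (x v : Fin (n + 1) → ℂ) :
    veroneseDifferential n d x v (coordExponent hd j i) =
      x j ^ (d - 1) * v i + x i * ((d - 1 : ℕ) * x j ^ (d - 1 - 1) * v j) := by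
  rw [veroneseDifferential_apply, exponentMonomial_coordExponent, differential_mul,
    differential_pow, differential_X, differential_X]
  simp

theorem veronese_injective (hd : d ≠ 0) : Function.Injective (veronese n d) := by
  intro p q h
  rw [← p.mk_rep, ← q.mk_rep] at h ⊢
  rw [veronese_mk, veronese_mk, Projectivization.mk_eq_mk_iff'] at h
  obtain ⟨a, ha⟩ := h
  obtain ⟨j, hj⟩ := Function.ne_iff.mp p.rep_nonzero
  rw [Projectivization.mk_eq_mk_iff']
  refine ⟨a * q.rep j ^ (d - 1) / p.rep j ^ (d - 1), ?_⟩
  funext i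
  have hi := congrFun ha (coordExponent hd j i)
  have hj' : p.rep j ^ (d - 1) ≠ 0 := pow_ne_zero _ hj
  simp only [Pi.smul_apply, veroneseVec_coordExponent, smul_eq_mul] at hi ⊢
  field_simp
  linear_combination hi

/-- The coordinates `x_j ^ (d - 1) * x_i` form an affine chart: the one with `i = j` has derivative
`d * x_j ^ (d - 1) * v_j`, which determines `v j`, and the others then determine each `v i`. -/
theorem veroneseDifferential_coord_injective (hd : d ≠ 0) {x : Fin (n + 1) → ℂ}
    {j : Fin (n + 1)} (hj : x j ≠ 0) :
    Function.Injective (LinearMap.funLeft ℂ ℂ (coordExponent (n := n) hd j) ∘ₗ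
      veroneseDifferential n d x) := by
  rw [injective_iff_map_eq_zero]
  intro v hv
  have h : ∀ i, x j ^ (d - 1) * v i + x i * ((d - 1 : ℕ) * x j ^ (d - 1 - 1) * v j) = 0 := by
    intro i
    rw [← veroneseDifferential_coordExponent hd]
    exact congrFun hv i
  have hvj : v j = 0 := by
    have h1 : (d : ℂ) * (x j ^ (d - 1) * v j) = 0 := by
      rw [← h j]
      obtain ⟨e, rfl⟩ := Nat.exists_eq_succ_of_ne_zero hd
      rcases e with _ | e
      · simp
      · simp only [Nat.succ_eq_add_one, Nat.add_sub_cancel]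
        push_cast
        ring
    simpa [hd, hj] using h1
  funext i
  simpa [hvj, hj] using h i

theorem differential_eq_zero_of_vanishesOn (x v : Fin (n + 1) → ℂ) {k : ℕ}
    {F : MvPolynomial (Exponents n d) ℂ} (hF : F.IsHomogeneous k)
    (hX : VanishesOn (veroneseVariety n d) F) :
    differential F (veroneseVec n d x) (veroneseDifferential n d x v) = 0 := by
  -- The hypothesis says nothing at the origin; the factor `X 0` makes the product vanish there too
  -- and is cancelled afterwards.
  have hG : X 0 * aeval exponentMonomial F = 0 := by
    refine MvPolynomial.funext fun y => ?_
    rw [map_mul, eval_X, map_zero]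
    by_cases hy : y = 0
    · simp [hy]
    have h := hX _ ⟨Projectivization.mk ℂ y hy, rfl⟩
    obtain ⟨a, ha⟩ := Projectivization.exists_smul_eq_mk_rep ℂ (veroneseVec n d y)
      (veroneseVec_ne_zero n d hy)
    rw [veronese_mk, ← ha, Units.smul_def, IsHomogeneous.eval_smul hF] at h
    have h2 : eval (veroneseVec n d y) F = 0 := by simpa using h
    have h3 : eval y (aeval exponentMonomial F) = eval (veroneseVec n d y) F := by
      simp only [aeval_eq_bind₁, ← coe_aeval_eq_eval, RingHom.coe_coe, aeval_bind₁]
      congr 2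
      funext α
      rw [← eval_exponentMonomial, ← coe_aeval_eq_eval, RingHom.coe_coe]
    rw [h3, h2, mul_zero]
  have hG' : aeval exponentMonomial F = 0 := by simpa using hG
  have h := differential_aeval exponentMonomial F x v
  simp only [hG', eval_exponentMonomial] at h
  rw [show (0 : MvPolynomial (Fin (n + 1)) ℂ) = C 0 by simp, differential_C] at h
  exact h.symm

theorem mem_tangentSpace_iff {σ : Type*} [Fintype σ] {X : Set (ℙ ℂ (σ → ℂ))} {p : ℙ ℂ (σ → ℂ)}
    {w : σ → ℂ} : w ∈ tangentSpace X p ↔ ∀ (k : ℕ) (F : MvPolynomial σ ℂ), F.IsHomogeneous k →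
      VanishesOn X F → differential F p.rep w = 0 := by
  simp only [differential_apply]
  rfl

/-- The equation `y_α y_{d e_j} ^ (d - 1) = ∏ i, y_{(d - 1) e_j + e_i} ^ α_i` of the Veronese
variety. -/
def veroneseEquation (hd : d ≠ 0) (j : Fin (n + 1)) (α : Exponents n d) :
    MvPolynomial (Exponents n d) ℂ :=
  X α * X (coordExponent hd j j) ^ (d - 1) -
    ∏ i, X (coordExponent hd j i) ^ (α : Fin (n + 1) → ℕ) i

theorem isHomogeneous_veroneseEquation (hd : d ≠ 0) (j : Fin (n + 1)) (α : Exponents n d) :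
    (veroneseEquation hd j α).IsHomogeneous d := by
  refine IsHomogeneous.sub ?_ ?_
  · have h := (isHomogeneous_X ℂ α).mul ((isHomogeneous_X ℂ (coordExponent hd j j)).pow (d - 1))
    rwa [show 1 + 1 * (d - 1) = d by omega] at h
  · have h := IsHomogeneous.prod Finset.univ
      (fun i => (X (coordExponent hd j i) : MvPolynomial (Exponents n d) ℂ) ^
        (α : Fin (n + 1) → ℕ) i) (fun i => 1 * (α : Fin (n + 1) → ℕ) i)
      fun i _ => (isHomogeneous_X ℂ _).pow _
    simpa [Finset.Nat.mem_antidiagonalTuple.mp α.2] using h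

theorem vanishesOn_veroneseEquation (hd : d ≠ 0) (j : Fin (n + 1)) (α : Exponents n d) :
    VanishesOn (veroneseVariety n d) (veroneseEquation hd j α) := by
  rintro _ ⟨p, rfl⟩
  obtain ⟨t, -, ht⟩ := exists_smul_veroneseVec_eq_rep hd p
  rw [ht]
  generalize t • p.rep = x
  simp only [veroneseEquation, map_sub, map_mul, map_pow, eval_X, map_prod,
    veroneseVec_coordExponent, mul_pow, Finset.prod_mul_distrib, Finset.prod_pow_eq_pow_sum,
    ← pow_mul, ← Finset.mul_sum, Finset.Nat.mem_antidiagonalTuple.mp α.2]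
  have hdd : (d - 1) * (d - 1) + (d - 1) = (d - 1) * d := by
    rw [← Nat.mul_succ, Nat.succ_eq_add_one, Nat.sub_add_cancel (Nat.pos_of_ne_zero hd)]
  rw [veroneseVec, ← pow_add, hdd]
  ring

/-- The embedded tangent space of the Veronese variety is the image of the differential of the
affine Veronese map. -/
theorem tangentSpace_veronese (hd : d ≠ 0) (p : ℙ ℂ (Fin (n + 1) → ℂ)) {x : Fin (n + 1) → ℂ}
    (hx : x ≠ 0) (hp : (veronese n d p).rep = veroneseVec n d x) :
    tangentSpace (veroneseVariety n d) (veronese n d p) =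
      LinearMap.range (veroneseDifferential n d x) := by
  have hle : LinearMap.range (veroneseDifferential n d x) ≤
      tangentSpace (veroneseVariety n d) (veronese n d p) := by
    rintro _ ⟨v, rfl⟩
    refine mem_tangentSpace_iff.mpr fun k F hF hX => ?_
    rw [hp]
    exact differential_eq_zero_of_vanishesOn x v hF hX
  refine le_antisymm (fun w hw => ?_) hle
  obtain ⟨j, hj⟩ := Function.ne_iff.mp hx
  -- Subtracting a tangent vector from the image kills all chart coordinates of `w`. For the
  -- remainder `u`, the differential of the equation indexed by `α` reduces to a power of `x j ≠ 0`
  -- times `u α`, so `u = 0`.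
  obtain ⟨v, hv⟩ := LinearMap.injective_iff_surjective.mp
    (veroneseDifferential_coord_injective (n := n) hd hj)
    (LinearMap.funLeft ℂ ℂ (coordExponent hd j) w)
  refine ⟨v, ?_⟩
  have hu := sub_mem hw (hle ⟨v, rfl⟩)
  have hu0 : ∀ i, (w - veroneseDifferential n d x v) (coordExponent hd j i) = 0 := by
    intro i
    have := congrFun hv i
    simp only [LinearMap.comp_apply, LinearMap.funLeft_apply] at this
    rw [Pi.sub_apply, this, sub_self]
  generalize hu' : w - veroneseDifferential n d x v = u at hu hu0
  suffices h : u = 0 by rw [h] at hu'; exact (sub_eq_zero.mp hu').symm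
  funext α
  have h := mem_tangentSpace_iff.mp hu d _ (isHomogeneous_veroneseEquation hd j α)
    (vanishesOn_veroneseEquation hd j α)
  rw [hp, veroneseEquation, differential_sub, differential_mul, differential_pow, differential_X,
    differential_X, hu0, differential_prod_eq_zero _ _ _ _ fun i _ => by
      rw [differential_pow, differential_X, hu0, mul_zero]] at h
  have hj' : x j ≠ 0 := hj
  simpa [veroneseVec_coordExponent, hj'] using h

/-- Injectivity of the differential gives every tangent space dimension `n + 1`, so no point is
singular. -/
theorem regularLocus_veroneseVariety (hd : d ≠ 0) :
    regularLocus (veroneseVariety n d) = veroneseVariety n d := by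
  have hfin : ∀ q ∈ veroneseVariety n d,
      finrank ℂ (tangentSpace (veroneseVariety n d) q) = n + 1 := by
    rintro _ ⟨p, rfl⟩
    obtain ⟨t, ht, hp⟩ := exists_smul_veroneseVec_eq_rep hd p
    have hx : t • p.rep ≠ 0 := smul_ne_zero ht p.rep_nonzero
    obtain ⟨j, hj⟩ := Function.ne_iff.mp hx
    rw [tangentSpace_veronese hd p hx hp, LinearMap.finrank_range_of_inj, finrank_fin_fun]
    have h := veroneseDifferential_coord_injective (n := n) hd hj
    rw [LinearMap.coe_comp] at h
    exact h.of_comp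
  exact Set.Subset.antisymm (fun p hp => hp.1) fun p hp =>
    ⟨hp, fun q hq => by rw [hfin p hp, hfin q hq]⟩

/-! ### Duality between the tangent span and singular forms -/

/-- The form `F` is singular at the points of `A`. -/
def SingularAlong {n : ℕ} (A : Set (ℙ ℂ (Fin (n + 1) → ℂ)))
    (F : MvPolynomial (Fin (n + 1)) ℂ) : Prop :=
  ∀ a ∈ A, differential F a.rep = 0

variable (d) in
/-- The common zeros of the forms of degree `d` that are singular at the points of `A`. -/
def singularBase (A : Set (ℙ ℂ (Fin (n + 1) → ℂ))) : Set (ℙ ℂ (Fin (n + 1) → ℂ)) :=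
  {b | ∀ F : MvPolynomial (Fin (n + 1)) ℂ, F.IsHomogeneous d → SingularAlong A F →
    eval b.rep F = 0}

/-- Composing a functional with the affine Veronese map gives a form of degree `d`; by the chain
rule the functional kills the tangent space at `a` exactly when that form is singular at `a`. -/
theorem tangentSpan_le_ker_iff (hd : d ≠ 0) (A : Set (ℙ ℂ (Fin (n + 1) → ℂ)))
    (f : Dual ℂ (Exponents n d → ℂ)) (c : Exponents n d → ℂ)
    (hf : ∀ w, f w = ∑ α, c α * w α) :
    tangentSpan (veroneseVariety n d) (veronese n d '' A) ≤ LinearMap.ker f ↔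
      SingularAlong A (formOf c) := by
  simp only [tangentSpan, iSup_le_iff, Set.forall_mem_image, SingularAlong]
  refine forall₂_congr fun a _ => ?_
  obtain ⟨t, ht, hp⟩ := exists_smul_veroneseVec_eq_rep hd a
  rw [tangentSpace_veronese hd a (smul_ne_zero ht a.rep_nonzero) hp, LinearMap.range_le_ker_iff]
  simp only [LinearMap.ext_iff, LinearMap.comp_apply, hf, ← differential_formOf,
    differential_smul_left (isHomogeneous_formOf c), LinearMap.zero_apply, mul_eq_zero,
    pow_ne_zero _ ht, false_or]

theorem exists_dual_coeff (f : Dual ℂ (Exponents n d → ℂ)) :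
    ∃ c : Exponents n d → ℂ, ∀ w, f w = ∑ α, c α * w α :=
  ⟨_, fun w => by
    rw [LinearMap.pi_apply_eq_sum_univ f w]
    exact Finset.sum_congr rfl fun α _ => mul_comm _ _⟩

/-- The linear functional with a given vector of coefficients. -/
def dualOfCoeff (c : Exponents n d → ℂ) : Dual ℂ (Exponents n d → ℂ) :=
  ∑ α, c α • LinearMap.proj α

theorem dualOfCoeff_apply (c w : Exponents n d → ℂ) :
    dualOfCoeff c w = ∑ α, c α * w α := by
  simp [dualOfCoeff]

theorem veronese_submodule_le_tangentSpan_iff (hd : d ≠ 0) (A : Set (ℙ ℂ (Fin (n + 1) → ℂ)))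
    (b : ℙ ℂ (Fin (n + 1) → ℂ)) :
    (veronese n d b).submodule ≤ tangentSpan (veroneseVariety n d) (veronese n d '' A) ↔
      b ∈ singularBase d A := by
  rw [veronese_submodule, Submodule.span_singleton_le_iff_mem]
  constructor
  · intro h F hF hA
    obtain ⟨c, rfl⟩ := exists_formOf_eq hF
    have := (tangentSpan_le_ker_iff hd A _ c (dualOfCoeff_apply c)).mpr hA h
    rwa [LinearMap.mem_ker, dualOfCoeff_apply, ← eval_formOf] at this
  · intro h
    by_contra hb
    obtain ⟨f, hfb, hf⟩ := Submodule.exists_le_ker_of_notMem hb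
    obtain ⟨c, hc⟩ := exists_dual_coeff f
    rw [tangentSpan_le_ker_iff hd A f c hc] at hf
    apply hfb
    rw [hc, ← eval_formOf]
    exact h _ (isHomogeneous_formOf c) hf

theorem extraPoints_veronese (hd : d ≠ 0) (A : Set (ℙ ℂ (Fin (n + 1) → ℂ))) :
    extraPoints (veroneseVariety n d) (veronese n d '' A) =
      veronese n d '' (singularBase d A \ A) := by
  ext q
  simp only [extraPoints, regularLocus_veroneseVariety hd, Set.mem_ofPred_eq, Set.mem_sdiff]
  constructor
  · rintro ⟨⟨⟨b, rfl⟩, hb⟩, h⟩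
    exact ⟨b, ⟨(veronese_submodule_le_tangentSpan_iff hd A b).mp h,
      fun hbA => hb ⟨b, hbA, rfl⟩⟩, rfl⟩
  · rintro ⟨b, ⟨hb, hbA⟩, rfl⟩
    exact ⟨⟨⟨b, rfl⟩, fun h => hbA ((veronese_injective hd).mem_set_image.mp h)⟩,
      (veronese_submodule_le_tangentSpan_iff hd A b).mpr hb⟩

theorem tangentSpan_ne_top (hd : d ≠ 0) {A : Set (ℙ ℂ (Fin (n + 1) → ℂ))}
    {F : MvPolynomial (Fin (n + 1)) ℂ} (hF : F.IsHomogeneous d) (h0 : F ≠ 0)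
    (hA : SingularAlong A F) :
    tangentSpan (veroneseVariety n d) (veronese n d '' A) ≠ ⊤ := by
  intro h
  obtain ⟨c, rfl⟩ := exists_formOf_eq hF
  have hle := (tangentSpan_le_ker_iff hd A _ c (dualOfCoeff_apply c)).mpr hA
  refine h0 (MvPolynomial.funext fun x => ?_)
  rw [eval_formOf, ← dualOfCoeff_apply, map_zero]
  exact hle (h ▸ Submodule.mem_top)

theorem image_veronese_mem_smoothSets_iff (hd : d ≠ 0) {r : ℕ}
    {A : Set (ℙ ℂ (Fin (n + 1) → ℂ))} :
    veronese n d '' A ∈ smoothSets r (veroneseVariety n d) ↔ A.encard = r := by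
  rw [smoothSets, Set.mem_ofPred_eq, regularLocus_veroneseVariety hd,
    (veronese_injective hd).encard_image]
  exact and_iff_right (Set.image_subset_range _ _)

theorem exists_image_veronese_of_mem_smoothSets (hd : d ≠ 0) {r : ℕ}
    {S : Set (ℙ ℂ (Exponents n d → ℂ))} (hS : S ∈ smoothSets r (veroneseVariety n d)) :
    ∃ A : Set (ℙ ℂ (Fin (n + 1) → ℂ)), A.encard = r ∧ veronese n d '' A = S := by
  have h := hS.1
  rw [regularLocus_veroneseVariety hd, veroneseVariety] at h
  obtain ⟨A, rfl⟩ := Set.subset_range_iff_exists_image_eq.mp h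
  exact ⟨A, (image_veronese_mem_smoothSets_iff hd).mp hS, rfl⟩

end Veronese

/-! ### Lines in projective space -/

section Lines

variable {V : Type*} [AddCommGroup V] [Module ℂ V] {a b p : ℙ ℂ V} {L R : Set (ℙ ℂ V)}

theorem submodule_le_iff {W : Submodule ℂ V} : p.submodule ≤ W ↔ p.rep ∈ W := by
  rw [Projectivization.submodule_eq, Submodule.span_singleton_le_iff_mem]

theorem sup_submodule_eq_span (a b : ℙ ℂ V) :
    a.submodule ⊔ b.submodule = Submodule.span ℂ {a.rep, b.rep} := by
  rw [Submodule.span_insert, Projectivization.submodule_eq, Projectivization.submodule_eq]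

theorem finrank_sup_submodule (h : a ≠ b) : finrank ℂ ↥(a.submodule ⊔ b.submodule) = 2 := by
  have hli := Projectivization.linearIndependent_pair_iff_ne.mpr h
  have := finrank_span_eq_card hli
  rwa [Matrix.range_cons, Matrix.range_cons, Matrix.range_empty, Set.union_empty,
    Set.singleton_union, ← sup_submodule_eq_span] at this

/-- The line through two points (a single point if they coincide). -/
def lineThrough (a b : ℙ ℂ V) : Set (ℙ ℂ V) :=
  {p | p.submodule ≤ a.submodule ⊔ b.submodule}

theorem left_mem_lineThrough (a b : ℙ ℂ V) : a ∈ lineThrough a b :=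
  le_sup_left (a := a.submodule)

theorem right_mem_lineThrough (a b : ℙ ℂ V) : b ∈ lineThrough a b :=
  le_sup_right (b := b.submodule)

theorem isLine_lineThrough (h : a ≠ b) : IsLine (lineThrough a b) :=
  ⟨_, finrank_sup_submodule h, rfl⟩

theorem sup_submodule_eq_of_le {W : Submodule ℂ V} (hW : finrank ℂ W = 2) (h : a ≠ b)
    (ha : a.submodule ≤ W) (hb : b.submodule ≤ W) : a.submodule ⊔ b.submodule = W := by
  have : FiniteDimensional ℂ W := FiniteDimensional.of_finrank_pos (by omega)
  exact Submodule.eq_of_le_of_finrank_eq (sup_le ha hb) (by rw [finrank_sup_submodule h, hW])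

theorem IsLine.eq_lineThrough (hL : IsLine L) (h : a ≠ b) (ha : a ∈ L) (hb : b ∈ L) :
    L = lineThrough a b := by
  obtain ⟨W, hW, rfl⟩ := hL
  rw [lineThrough, sup_submodule_eq_of_le hW h ha hb]

theorem IsLine.inter_subsingleton (hL : IsLine L) (hR : IsLine R) (h : L ≠ R) :
    (L ∩ R).Subsingleton := by
  intro p hp q hq
  by_contra hpq
  exact h ((hL.eq_lineThrough hpq hp.1 hq.1).trans (hR.eq_lineThrough hpq hp.2 hq.2).symm)

/-- A point of the line through `a` and `b` other than `b` is represented by a vector `a + t b`. -/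
theorem exists_rep_eq_of_mem_lineThrough (hp : p ∈ lineThrough a b) (hpb : p ≠ b) :
    ∃ s t : ℂ, s ≠ 0 ∧ p.rep = s • (a.rep + t • b.rep) := by
  have h : p.rep ∈ Submodule.span ℂ {a.rep, b.rep} := by
    rw [← sup_submodule_eq_span]
    exact submodule_le_iff.mp hp
  obtain ⟨s, t, hst⟩ := Submodule.mem_span_pair.mp h
  have hs : s ≠ 0 := by
    rintro rfl
    apply hpb
    rw [← p.mk_rep, ← b.mk_rep, Projectivization.mk_eq_mk_iff']
    exact ⟨t, by rw [← hst]; simp⟩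
  refine ⟨s, s⁻¹ * t, hs, ?_⟩
  rw [smul_add, smul_smul, ← mul_assoc, mul_inv_cancel₀ hs, one_mul, hst]

theorem infinite_lineThrough (h : a ≠ b) : (lineThrough a b).Infinite := by
  have hli := Projectivization.linearIndependent_pair_iff_ne.mpr h
  rw [LinearIndependent.pair_iff] at hli
  have hne : ∀ t : ℂ, a.rep + t • b.rep ≠ 0 := fun t ht =>
    one_ne_zero (hli 1 t (by rw [one_smul, ht])).1
  refine Set.infinite_of_injective_forall_mem
    (f := fun t : ℂ => Projectivization.mk ℂ (a.rep + t • b.rep) (hne t)) ?_ ?_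
  · intro t u htu
    obtain ⟨c, hc⟩ := (Projectivization.mk_eq_mk_iff' ℂ _ _ _ _).mp htu
    obtain ⟨h1, h2⟩ := hli (c - 1) (c * u - t) (by
      rw [← sub_eq_zero.mpr hc]
      module)
    have hc1 : c = 1 := sub_eq_zero.mp h1
    rw [hc1, one_mul, sub_eq_zero] at h2
    exact h2.symm
  · intro t
    rw [lineThrough, Set.mem_ofPred_eq, Projectivization.submodule_mk,
      Submodule.span_singleton_le_iff_mem, sup_submodule_eq_span]
    exact Submodule.mem_span_pair.mpr ⟨1, t, by rw [one_smul]⟩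

theorem exists_dual_of_notMem_lineThrough (h : b ∉ lineThrough a p) :
    ∃ l : Dual ℂ V, l b.rep ≠ 0 ∧ l a.rep = 0 ∧ l p.rep = 0 := by
  rw [lineThrough, Set.mem_ofPred_eq, submodule_le_iff] at h
  obtain ⟨l, hl, hle⟩ := Submodule.exists_le_ker_of_notMem h
  exact ⟨l, hl, submodule_le_iff.mp (le_sup_left.trans hle),
    submodule_le_iff.mp (le_sup_right.trans hle)⟩

/-- If `b` were on the line through `a` and `p`, joining `b` to either point would give that same
line. -/
theorem notMem_lineThrough_of_ne (ha : a ≠ b) (hp : p ≠ b)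
    (h : b.submodule ⊔ a.submodule ≠ b.submodule ⊔ p.submodule) : b ∉ lineThrough a p := by
  intro hb
  have hap : a ≠ p := by rintro rfl; exact h rfl
  have hfin := finrank_sup_submodule hap
  exact h ((sup_submodule_eq_of_le hfin ha.symm hb le_sup_left).trans
    (sup_submodule_eq_of_le hfin hp.symm hb le_sup_right).symm)

theorem notMem_lineThrough_self (h : a ≠ b) : b ∉ lineThrough a a := by
  intro hb
  rw [lineThrough, Set.mem_ofPred_eq, sup_idem] at hb
  refine h (Projectivization.submodule_injective (Submodule.eq_of_le_of_finrank_eq hb ?_)).symm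
  rw [Projectivization.finrank_submodule, Projectivization.finrank_submodule]

end Lines

theorem polynomial_eq_zero_of_double_roots {f : Polynomial ℂ} (T : Finset ℂ)
    (h0 : ∀ t ∈ T, f.eval t = 0) (h1 : ∀ t ∈ T, f.derivative.eval t = 0)
    (hdeg : f.natDegree < 2 * T.card) : f = 0 := by
  by_contra hf
  have hle : 2 • T.val ≤ f.roots := by
    rw [Multiset.le_iff_count]
    intro t
    rw [Multiset.count_nsmul, Polynomial.count_roots]
    by_cases ht : t ∈ T
    · have := (Polynomial.one_lt_rootMultiplicity_iff_isRoot (t := t) hf).mpr ⟨h0 t ht, h1 t ht⟩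
      have := Multiset.nodup_iff_count_le_one.mp T.nodup t
      omega
    · rw [Multiset.count_eq_zero.mpr ht]
      simp
  have := (Multiset.card_le_card hle).trans f.card_roots'
  rw [Multiset.card_nsmul, Finset.card_val] at this
  omega

/-! ### The base locus of the forms singular along a set -/

section Base

variable {n d : ℕ} {A L : Set (ℙ ℂ (Fin (n + 1) → ℂ))}

theorem subset_singularBase_self (hd : d ≠ 0) : A ⊆ singularBase d A := by
  intro a ha F hF hA
  have h := IsHomogeneous.differential_self hF a.rep
  rw [hA a ha, LinearMap.zero_apply] at h
  simpa [hd] using h.symm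

theorem line_subset_singularBase (hd : d ≠ 0) (hL : IsLine L)
    {T : Finset (ℙ ℂ (Fin (n + 1) → ℂ))} (hT : ↑T ⊆ A ∩ L) (hcard : d + 1 ≤ 2 * T.card) :
    L ⊆ singularBase d A := by
  intro b hb
  by_cases hbA : b ∈ A
  · exact subset_singularBase_self hd hbA
  intro F hF hA
  have hne : ∀ a ∈ T, a ≠ b := fun a ha hab => hbA (hab ▸ (hT ha).1)
  obtain ⟨a₀, ha₀⟩ : T.Nonempty := Finset.card_pos.mp (by omega)
  -- The line is parametrized by `a₀ + t b` with `b` at infinity. As `b ∉ A`, every point of `T` has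
  -- a finite parameter and gives a double root.
  have hLeq := hL.eq_lineThrough (hne a₀ ha₀) (hT ha₀).2 hb
  have hex : ∀ a ∈ T, ∃ t s : ℂ, s ≠ 0 ∧ a.rep = s • (a₀.rep + t • b.rep) := by
    intro a ha
    obtain ⟨s, t, h⟩ := exists_rep_eq_of_mem_lineThrough (hLeq ▸ (hT ha).2) (hne a ha)
    exact ⟨t, s, h⟩
  choose! τ hτ using hex
  have hsing : ∀ a ∈ T, differential F (a₀.rep + τ a • b.rep) = 0 := by
    intro a ha
    obtain ⟨s, hs, hrep⟩ := hτ a ha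
    ext v
    have h := hA a (hT ha).1
    rw [hrep] at h
    have h' := LinearMap.congr_fun h (Pi.single v 1)
    rw [differential_smul_left hF] at h'
    simpa [hs] using h'
  have hinj : Set.InjOn τ T := by
    intro a ha a' ha' haa'
    obtain ⟨s, hs, hrep⟩ := hτ a ha
    obtain ⟨s', hs', hrep'⟩ := hτ a' ha'
    rw [← a.mk_rep, ← a'.mk_rep, Projectivization.mk_eq_mk_iff']
    refine ⟨s / s', ?_⟩
    rw [hrep, hrep', haa', smul_smul, div_mul_cancel₀ _ hs']
  have hline : ∀ t : ℂ, eval (a₀.rep + t • b.rep) F = 0 := by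
    set f : Polynomial ℂ := aeval (fun i => Polynomial.C (a₀.rep i) +
      Polynomial.C (b.rep i) * Polynomial.X) F with hf
    have hfun : ∀ t : ℂ, (fun i => Polynomial.eval t (Polynomial.C (a₀.rep i) +
        Polynomial.C (b.rep i) * Polynomial.X)) = a₀.rep + t • b.rep := by
      intro t
      funext i
      simp only [Polynomial.eval_add, Polynomial.eval_mul, Polynomial.eval_C, Polynomial.eval_X,
        Pi.add_apply, Pi.smul_apply, smul_eq_mul]
      ring
    have heval : ∀ t, f.eval t = eval (a₀.rep + t • b.rep) F := fun t => by
      rw [hf, eval_eval_aeval, hfun]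
    have hf0 : f = 0 := by
      refine polynomial_eq_zero_of_double_roots (T.image τ) ?_ ?_ ?_
      · rw [Finset.forall_mem_image]
        intro a ha
        have h := IsHomogeneous.differential_self hF (a₀.rep + τ a • b.rep)
        rw [hsing a ha, LinearMap.zero_apply] at h
        rw [heval]
        simpa [hd] using h.symm
      · rw [Finset.forall_mem_image]
        intro a ha
        rw [hf, eval_derivative_aeval, hfun, hsing a ha, LinearMap.zero_apply]
      · rw [Finset.card_image_of_injOn hinj]
        have h := aeval_natDegree_le (m := d) (n := 1) F hF.totalDegree_le
          (fun i => Polynomial.C (a₀.rep i) + Polynomial.C (b.rep i) * Polynomial.X)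
          fun i => by compute_degree
        rw [← hf] at h
        omega
    intro t
    rw [← heval, hf0, Polynomial.eval_zero]
  -- The point `b` itself is reached in the opposite chart `b + t a₀`. Homogeneity transfers the
  -- vanishing only for `t ≠ 0`, hence the factor `X` in `hg0`.
  set g : Polynomial ℂ := aeval (fun i => Polynomial.C (b.rep i) +
    Polynomial.C (a₀.rep i) * Polynomial.X) F with hg
  have heval : ∀ t, g.eval t = eval (b.rep + t • a₀.rep) F := by
    intro t
    rw [hg, eval_eval_aeval]
    congr 2
    funext i
    simp only [Polynomial.eval_add, Polynomial.eval_mul, Polynomial.eval_C, Polynomial.eval_X,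
      Pi.add_apply, Pi.smul_apply, smul_eq_mul]
    ring
  have hg0 : Polynomial.X * g = 0 := by
    refine Polynomial.funext fun t => ?_
    by_cases ht : t = 0
    · simp [ht]
    have h : b.rep + t • a₀.rep = t • (a₀.rep + t⁻¹ • b.rep) := by
      rw [smul_add, smul_smul, mul_inv_cancel₀ ht, one_smul]
      exact add_comm _ _
    rw [Polynomial.eval_mul, heval, h, IsHomogeneous.eval_smul hF, hline]
    simp
  have hg0' : g = 0 := by simpa using hg0
  have h := heval 0
  rw [hg0', zero_smul, add_zero, Polynomial.eval_zero] at h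
  exact h.symm

/-- Sorting by the label `c`, for an arbitrary linear order on labels, makes each fibre an interval
of indices. -/
theorem exists_enumeration_grouped {ι κ : Type*} {S : Set ι} {r : ℕ} (hS : S.encard = r)
    (c : ι → κ) : ∃ a : Fin r → ι, Function.Injective a ∧ Set.range a = S ∧
      ∀ i k j, i ≤ k → k ≤ j → c (a i) = c (a j) → c (a k) = c (a i) := by
  classical
  let _ : LinearOrder κ := linearOrderOfSTO WellOrderingRel
  have hfin : S.Finite := Set.finite_of_encard_eq_coe hS
  have : Finite S := hfin
  have hcard : Nat.card S = r := by
    rw [Nat.card_coe_set_eq, Set.ncard, hS]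
    rfl
  let e : Fin r ≃ S := (Finite.equivFinOfCardEq hcard).symm
  let σ := Tuple.sort fun k => c (e k)
  have hmono : Monotone fun k => c (e (σ k)) := Tuple.monotone_sort fun k => c (e k)
  refine ⟨fun k => e (σ k), Subtype.val_injective.comp (e.injective.comp σ.injective), ?_, ?_⟩
  · change Set.range (Subtype.val ∘ (e ∘ σ)) = S
    rw [Set.range_comp, (e.surjective.comp σ.surjective).range_eq, Set.image_univ,
      Subtype.range_coe]
  · intro i k j hik hkj hij
    exact le_antisymm ((hmono hkj).trans_eq hij.symm) (hmono hik)

theorem singularAlong_prod_linearForm (l : Fin d → Dual ℂ (Fin (n + 1) → ℂ))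
    (h : ∀ a ∈ A, ∃ i j, i ≠ j ∧ l i a.rep = 0 ∧ l j a.rep = 0) :
    SingularAlong A (∏ i, linearForm (l i)) := by
  intro a ha
  obtain ⟨i, j, hij, hi, hj⟩ := h a ha
  ext v
  rw [← Finset.mul_prod_erase _ _ (Finset.mem_univ i),
    ← Finset.mul_prod_erase _ _ (Finset.mem_erase.mpr ⟨hij.symm, Finset.mem_univ j⟩),
    LinearMap.comp_apply, differential_mul_mul_eq_zero]
  · simp
  · rw [eval_linearForm, hi]
  · rw [eval_linearForm, hj]

theorem isHomogeneous_prod_linearForm (l : Fin d → Dual ℂ (Fin (n + 1) → ℂ)) :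
    (∏ i, linearForm (l i)).IsHomogeneous d := by
  simpa using IsHomogeneous.prod Finset.univ (fun i => linearForm (l i)) (fun _ => 1)
    fun i _ => isHomogeneous_linearForm (l i)

/-- If `A` has at most `d` points and no line through `b` contains more than `d / 2` of them,
then a product of `d` linear forms is singular along `A` and does not vanish at `b`. -/
theorem notMem_singularBase (hd : 2 ≤ d) {r : ℕ} (hr : r ≤ d) (hA : A.encard = r)
    {b : ℙ ℂ (Fin (n + 1) → ℂ)} (hb : b ∉ A)
    (hlines : ∀ L, IsLine L → b ∈ L → ∀ T : Finset (ℙ ℂ (Fin (n + 1) → ℂ)), ↑T ⊆ A ∩ L →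
      2 * T.card ≤ d) : b ∉ singularBase d A := by
  obtain ⟨a, hinj, hrange, hgroup⟩ :=
    exists_enumeration_grouped hA fun p => b.submodule ⊔ p.submodule
  have hne : ∀ k, a k ≠ b := fun k hk => hb (hk ▸ hrange ▸ ⟨k, rfl⟩)
  -- List each point twice, the slots `2k` and `2k + 1` holding `a k`, and let the form `i` take the
  -- slots `i` and `i + d`. Points on one line through `b` are consecutive, so two slots this far
  -- apart cannot share such a line.
  have hex : ∀ i : Fin d, ∃ l : Dual ℂ (Fin (n + 1) → ℂ), l b.rep ≠ 0 ∧
      ∀ k : Fin r, ((k : ℕ) = i / 2 ∨ (k : ℕ) = (i + d) / 2) → l (a k).rep = 0 := by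
    intro i
    by_cases h2 : ((i : ℕ) + d) / 2 < r
    · have h1 : (i : ℕ) / 2 < r := by omega
      have hle : (⟨(i : ℕ) / 2, h1⟩ : Fin r) ≤ ⟨((i : ℕ) + d) / 2, h2⟩ := by
        rw [Fin.mk_le_mk]
        omega
      obtain ⟨l, hl, hl1, hl2⟩ := exists_dual_of_notMem_lineThrough
        (notMem_lineThrough_of_ne (hne ⟨i / 2, h1⟩) (hne ⟨(i + d) / 2, h2⟩) (by
          intro heq
          -- Otherwise the whole block of indices between them lies on that line: at least `⌊d / 2⌋
          -- + 1` points, too many.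
          have := hlines _ (isLine_lineThrough (hne ⟨i / 2, h1⟩).symm) (left_mem_lineThrough _ _)
            ((Finset.Icc (⟨(i : ℕ) / 2, h1⟩ : Fin r) ⟨(i + d) / 2, h2⟩).map ⟨a, hinj⟩) (by
              intro p hp
              simp only [Finset.coe_map, Function.Embedding.coeFn_mk, Set.mem_image,
                Finset.coe_Icc, Set.mem_Icc] at hp
              obtain ⟨k, ⟨hk1, hk2⟩, rfl⟩ := hp
              refine ⟨hrange ▸ ⟨k, rfl⟩, ?_⟩
              have := hgroup _ k _ hk1 hk2 heq
              rw [lineThrough, Set.mem_ofPred_eq, ← this]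
              exact le_sup_right)
          rw [Finset.card_map, Fin.card_Icc] at this
          simp only at this
          omega))
      refine ⟨l, hl, fun k hk => ?_⟩
      rcases hk with hk | hk
      · rwa [show k = ⟨i / 2, h1⟩ from Fin.ext hk]
      · rwa [show k = ⟨(i + d) / 2, h2⟩ from Fin.ext hk]
    · by_cases h1 : (i : ℕ) / 2 < r
      · obtain ⟨l, hl, hl1, -⟩ := exists_dual_of_notMem_lineThrough
          (notMem_lineThrough_self (hne ⟨i / 2, h1⟩))
        refine ⟨l, hl, fun k hk => ?_⟩
        rwa [show k = ⟨i / 2, h1⟩ from Fin.ext (by have := k.2; simp only; omega)]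
      · obtain ⟨l, hl⟩ := Projective.exists_dual_ne_zero ℂ b.rep_nonzero
        exact ⟨l, hl, fun k hk => by have := k.2; omega⟩
  choose l hlb hl using hex
  intro hbase
  refine absurd (hbase _ (isHomogeneous_prod_linearForm l) ?_) ?_
  · rw [← hrange]
    refine singularAlong_prod_linearForm l (Set.forall_mem_range.mpr fun k => ?_)
    have hk := k.2
    -- The forms through `a k` are the residues of `2k` and `2k + 1` modulo `d`, distinct because `d
    -- ≥ 2`.
    suffices h : ∃ i j : Fin d, i ≠ j ∧ ((k : ℕ) = i / 2 ∨ (k : ℕ) = (i + d) / 2) ∧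
        ((k : ℕ) = j / 2 ∨ (k : ℕ) = (j + d) / 2) by
      obtain ⟨i, j, hij, hi, hj⟩ := h
      exact ⟨i, j, hij, hl i k hi, hl j k hj⟩
    rcases lt_or_ge (2 * (k : ℕ) + 1) d with h | h
    · exact ⟨⟨2 * k, by omega⟩, ⟨2 * k + 1, h⟩, by simp, by simp only; omega, by simp only; omega⟩
    rcases lt_or_ge (2 * (k : ℕ)) d with h' | h'
    · exact ⟨⟨2 * k, h'⟩, ⟨2 * k + 1 - d, by omega⟩, by rw [Ne, Fin.mk.injEq]; omega,
        by simp only; omega, by simp only; omega⟩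
    · exact ⟨⟨2 * k - d, by omega⟩, ⟨2 * k + 1 - d, by omega⟩, by rw [Ne, Fin.mk.injEq]; omega,
        by simp only; omega, by simp only; omega⟩
  · rw [map_prod]
    refine Finset.prod_ne_zero_iff.mpr fun i _ => ?_
    rw [eval_linearForm]
    exact hlb i

end Base

/-! ### Heavy lines and counting -/

variable {n d r : ℕ} {A L R T : Set (ℙ ℂ (Fin (n + 1) → ℂ))}

theorem exists_dual_of_isLine (hn : 2 ≤ n) (hL : IsLine L) :
    ∃ l : Dual ℂ (Fin (n + 1) → ℂ), l ≠ 0 ∧ ∀ p ∈ L, l p.rep = 0 := by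
  obtain ⟨W, hW, rfl⟩ := hL
  have hlt : W < ⊤ := by
    rw [lt_top_iff_ne_top]
    rintro rfl
    rw [finrank_top, finrank_fin_fun] at hW
    omega
  obtain ⟨l, hl, hle⟩ := W.exists_le_ker_of_lt_top hlt
  exact ⟨l, hl, fun p hp => hle (submodule_le_iff.mp hp)⟩

theorem tangentSpan_ne_top_of_linearForms (hd : d ≠ 0) (l : Fin d → Dual ℂ (Fin (n + 1) → ℂ))
    (h0 : ∀ i, l i ≠ 0) (h : ∀ a ∈ A, ∃ i j, i ≠ j ∧ l i a.rep = 0 ∧ l j a.rep = 0) :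
    tangentSpan (veroneseVariety n d) (veronese n d '' A) ≠ ⊤ := by
  refine tangentSpan_ne_top hd (isHomogeneous_prod_linearForm l) ?_
    (singularAlong_prod_linearForm l h)
  refine Finset.prod_ne_zero_iff.mpr fun i _ hi => h0 i (LinearMap.ext fun x => ?_)
  rw [← eval_linearForm, hi, map_zero, LinearMap.zero_apply]

/-- A line that contains more than `d / 2` of the points of `A`. -/
def IsHeavyLine (d : ℕ) (A L : Set (ℙ ℂ (Fin (n + 1) → ℂ))) : Prop :=
  IsLine L ∧ d + 1 ≤ 2 * (A ∩ L).ncard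

theorem IsHeavyLine.subset_singularBase (hd : d ≠ 0) (hA : A.Finite) (hL : IsHeavyLine d A L) :
    L ⊆ singularBase d A := by
  have hfin := hA.inter_of_left L
  refine line_subset_singularBase hd hL.1 (T := hfin.toFinset) (by simp) ?_
  rw [← Set.ncard_eq_toFinset_card _ hfin]
  exact hL.2

theorem exists_heavyLine_of_mem_singularBase (hd : 2 ≤ d) (hr : r ≤ d) (hA : A.encard = r)
    {b : ℙ ℂ (Fin (n + 1) → ℂ)} (hb : b ∈ singularBase d A \ A) :
    ∃ L, IsHeavyLine d A L ∧ b ∈ L := by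
  by_contra! h
  refine notMem_singularBase hd hr hA hb.2 (fun L hL hbL T hT => ?_) hb.1
  by_contra! hlt
  refine h L ⟨hL, ?_⟩ hbL
  have hfin := (Set.finite_of_encard_eq_coe hA).inter_of_left L
  have := Set.ncard_le_ncard hT hfin
  rw [Set.ncard_coe_finset] at this
  omega

theorem singularBase_diff_eq (hd : 2 ≤ d) (hr : r ≤ d) (hA : A.encard = r) :
    singularBase d A \ A = {b | ∃ L, IsHeavyLine d A L ∧ b ∈ L} \ A := by
  ext b
  refine ⟨fun hb => ⟨exists_heavyLine_of_mem_singularBase hd hr hA hb, hb.2⟩, ?_⟩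
  rintro ⟨⟨L, hL, hbL⟩, hb⟩
  exact ⟨hL.subset_singularBase (by omega) (Set.finite_of_encard_eq_coe hA) hbL, hb⟩

theorem extraPoints_eq_of_forall_heavyLine (hd : 2 ≤ d) (hr : r ≤ d) (hA : A.encard = r)
    {S : Set (ℙ ℂ (Fin (n + 1) → ℂ))} (hS : ∀ b, (∃ L, IsHeavyLine d A L ∧ b ∈ L) ↔ b ∈ S) :
    extraPoints (veroneseVariety n d) (veronese n d '' A) = veronese n d '' (S \ A) := by
  rw [extraPoints_veronese (by omega), singularBase_diff_eq hd hr hA]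
  simp only [hS, Set.ofPred_mem_eq]

theorem ncard_inter_add_ncard_inter (hA : A.Finite) (hL : IsLine L) (hR : IsLine R) (h : L ≠ R) :
    (A ∩ L).ncard + (A ∩ R).ncard = (A ∩ (L ∪ R)).ncard + (A ∩ (L ∩ R)).ncard ∧
      (A ∩ (L ∩ R)).ncard ≤ 1 := by
  rw [Set.inter_union_distrib_left, Set.inter_inter_distrib_left]
  refine ⟨(Set.ncard_union_add_ncard_inter _ _ (hA.inter_of_left _) (hA.inter_of_left _)).symm, ?_⟩
  have : Finite ↥(A ∩ L ∩ (A ∩ R)) := (hA.inter_of_left _).inter_of_left _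
  rw [Set.ncard_le_one_iff_subsingleton]
  exact (hL.inter_subsingleton hR h).anti
    (Set.inter_subset_inter Set.inter_subset_right Set.inter_subset_right)

/-- Two distinct heavy lines would contain at least `d` points of `A` together, and at least `d + 1`
when `d` is even. -/
theorem IsHeavyLine.eq_of_lt (hA : A.encard = r) (hr : r < d ∨ r = d ∧ Even d)
    (hL : IsHeavyLine d A L) (hR : IsHeavyLine d A R) : L = R := by
  by_contra h
  have hfin := Set.finite_of_encard_eq_coe hA
  obtain ⟨h1, h2⟩ := ncard_inter_add_ncard_inter hfin hL.1 hR.1 h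
  have h3 := Set.ncard_le_ncard (Set.inter_subset_left (s := A) (t := L ∪ R)) hfin
  have h4 : A.ncard = r := by rw [Set.ncard, hA]; rfl
  have hL2 := hL.2
  have hR2 := hR.2
  rcases hr with hr | ⟨rfl, e, he⟩ <;> omega

/-- Two heavy lines for a set of `d` points. -/
theorem IsHeavyLine.of_ne (hA : A.encard = d) (hodd : Odd d) (hL : IsHeavyLine d A L)
    (hR : IsHeavyLine d A R) (h : L ≠ R) :
    (∃ p ∈ A, L ∩ R = {p}) ∧ (A ∩ L).ncard = (d + 1) / 2 ∧ (A ∩ R).ncard = (d + 1) / 2 ∧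
      A ⊆ L ∪ R := by
  have hfin := Set.finite_of_encard_eq_coe hA
  obtain ⟨h1, h2⟩ := ncard_inter_add_ncard_inter hfin hL.1 hR.1 h
  have h3 := Set.ncard_le_ncard (Set.inter_subset_left (s := A) (t := L ∪ R)) hfin
  have h4 : A.ncard = d := by rw [Set.ncard, hA]; rfl
  have hL2 := hL.2
  have hR2 := hR.2
  -- With `d = 2e + 1` each line carries at least `e + 1` points, while the two counts sum to at
  -- most `d + 1`; every inequality is therefore an equality.
  obtain ⟨e, rfl⟩ := hodd
  refine ⟨?_, by omega, by omega, ?_⟩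
  · obtain ⟨p, hpA, hp⟩ : (A ∩ (L ∩ R)).Nonempty :=
      Set.nonempty_of_ncard_ne_zero (by omega)
    exact ⟨p, hpA, (hL.1.inter_subsingleton hR.1 h).eq_singleton_of_mem hp⟩
  · exact Set.inter_eq_left.mp
      (Set.eq_of_subset_of_ncard_le Set.inter_subset_left (by omega) hfin)

/-- All of `A` lies on `L ∪ R`, so a third line meets `A` in at most two points, whereas heaviness
requires three once `d ≥ 5`. -/
theorem IsHeavyLine.eq_or_eq (hd : 5 ≤ d) (hA : A.encard = d) (hodd : Odd d)
    (hL : IsHeavyLine d A L) (hR : IsHeavyLine d A R) (h : L ≠ R) (hT : IsHeavyLine d A T) :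
    T = L ∨ T = R := by
  by_contra! hne
  have hfin := Set.finite_of_encard_eq_coe hA
  obtain ⟨-, -, -, hsub⟩ := hL.of_ne hA hodd hR h
  obtain ⟨-, h1⟩ := ncard_inter_add_ncard_inter hfin hT.1 hL.1 hne.1
  obtain ⟨-, h2⟩ := ncard_inter_add_ncard_inter hfin hT.1 hR.1 hne.2
  have h3 : A ∩ T ⊆ A ∩ (T ∩ L) ∪ A ∩ (T ∩ R) := fun p hp =>
    (hsub hp.1).imp (fun hpL => ⟨hp.1, hp.2, hpL⟩) (fun hpR => ⟨hp.1, hp.2, hpR⟩)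
  have h4 := (Set.ncard_le_ncard h3 ((hfin.inter_of_left _).union (hfin.inter_of_left _))).trans
    (Set.ncard_union_le _ _)
  have hT2 := hT.2
  omega

theorem exists_isLine (hn : 1 ≤ n) : ∃ L : Set (ℙ ℂ (Fin (n + 1) → ℂ)), IsLine L ∧ L.Infinite := by
  have : Nontrivial (Fin (n + 1)) := Fin.nontrivial_iff_two_le.mpr (by omega)
  obtain ⟨i, j, hij⟩ := exists_pair_ne (Fin (n + 1))
  have hne : ∀ k : Fin (n + 1), (Pi.single k 1 : Fin (n + 1) → ℂ) ≠ 0 := by simp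
  have h : Projectivization.mk ℂ _ (hne i) ≠ Projectivization.mk ℂ _ (hne j) := by
    rw [Ne, Projectivization.mk_eq_mk_iff']
    rintro ⟨t, ht⟩
    have := congrFun ht i
    simp [hij] at this
  exact ⟨_, isLine_lineThrough h, infinite_lineThrough h⟩

theorem baseLocus_nonempty_iff (hn : 2 ≤ n) (hd : 2 ≤ d) (r : ℕ) :
    (baseLocus r (veroneseVariety n d)).Nonempty ↔ d + 1 ≤ 2 * r := by
  have hd0 : d ≠ 0 := by omega
  constructor
  · rintro ⟨S, hS, -, hex⟩
    obtain ⟨A, hA, rfl⟩ := exists_image_veronese_of_mem_smoothSets hd0 hS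
    rw [extraPoints_veronese hd0, Set.image_nonempty] at hex
    obtain ⟨b, hb⟩ := hex
    by_contra! hlt
    obtain ⟨L, hL, -⟩ := exists_heavyLine_of_mem_singularBase hd (by omega) hA hb
    have h1 := Set.ncard_le_ncard (Set.inter_subset_left (s := A) (t := L))
      (Set.finite_of_encard_eq_coe hA)
    have h2 : A.ncard = r := by rw [Set.ncard, hA]; rfl
    have h3 := hL.2
    omega
  · intro hr
    obtain ⟨L, hL, hinf⟩ := exists_isLine (n := n) (by omega)
    obtain ⟨A, hAL, hfin, hcard⟩ := hinf.exists_subset_ncard_eq r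
    refine ⟨veronese n d '' A, ?_, ?_, ?_⟩
    · rw [image_veronese_mem_smoothSets_iff hd0, ← hfin.cast_ncard_eq, hcard]
    -- The `d`-th power of one linear form vanishing on `L` is singular along `A`; such a form
    -- exists because `n ≥ 2`.
    · obtain ⟨l, hl, hlL⟩ := exists_dual_of_isLine hn hL
      exact tangentSpan_ne_top_of_linearForms hd0 (fun _ => l) (fun _ => hl) fun a ha =>
        ⟨⟨0, by omega⟩, ⟨1, by omega⟩, by simp, hlL a (hAL ha), hlL a (hAL ha)⟩
    · rw [extraPoints_veronese hd0, Set.image_nonempty]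
      obtain ⟨b, hb⟩ := (hinf.sdiff hfin).nonempty
      have hheavy : IsHeavyLine d A L :=
        ⟨hL, by rwa [Set.inter_eq_left.mpr hAL, hcard]⟩
      exact ⟨b, hheavy.subset_singularBase hd0 hfin hb.1, hb.2⟩

theorem exists_heavyLine_of_mem_baseLocus (hd : 2 ≤ d) (hr : r ≤ d) (hA : A.encard = r)
    (h : veronese n d '' A ∈ baseLocus r (veroneseVariety n d)) : ∃ L, IsHeavyLine d A L := by
  have hex := h.2.2
  rw [extraPoints_veronese (by omega), Set.image_nonempty] at hex
  obtain ⟨b, hb⟩ := hex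
  obtain ⟨L, hL, -⟩ := exists_heavyLine_of_mem_singularBase hd hr hA hb
  exact ⟨L, hL⟩

theorem extraPoints_of_unique_heavyLine (hd : 2 ≤ d) (hr : r ≤ d) (hA : A.encard = r)
    (hL : IsHeavyLine d A L) (huniq : ∀ R, IsHeavyLine d A R → R = L) :
    extraPoints (veroneseVariety n d) (veronese n d '' A) = veronese n d '' (L \ A) :=
  extraPoints_eq_of_forall_heavyLine hd hr hA fun _ =>
    ⟨fun ⟨R, hR, hb⟩ => huniq R hR ▸ hb, fun hb => ⟨L, hL, hb⟩⟩

theorem ceil_half_le_iff (d k : ℕ) : ⌈((d : ℚ) + 1) / 2⌉₊ ≤ k ↔ d + 1 ≤ 2 * k := by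
  rw [Nat.ceil_le, div_le_iff₀ two_pos, mul_comm]
  norm_cast

/-! ### Three points and cubics -/

theorem heavyLine_iff_of_three {a b c : ℙ ℂ (Fin (n + 1) → ℂ)} (hab : a ≠ b) (hac : a ≠ c)
    (hbc : b ≠ c) : IsHeavyLine 3 {a, b, c} L ↔
      L = lineThrough a b ∨ L = lineThrough a c ∨ L = lineThrough b c := by
  have hfin : ({a, b, c} : Set (ℙ ℂ (Fin (n + 1) → ℂ))).Finite := Set.toFinite _
  have key : ∀ p q, p ≠ q → p ∈ ({a, b, c} : Set (ℙ ℂ (Fin (n + 1) → ℂ))) →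
      q ∈ ({a, b, c} : Set (ℙ ℂ (Fin (n + 1) → ℂ))) →
      IsHeavyLine 3 {a, b, c} (lineThrough p q) := by
    intro p q hpq hp hq
    refine ⟨isLine_lineThrough hpq, ?_⟩
    have hsub : {p, q} ⊆ ({a, b, c} : Set (ℙ ℂ (Fin (n + 1) → ℂ))) ∩ lineThrough p q := by
      rintro x (rfl | rfl)
      · exact ⟨hp, left_mem_lineThrough _ _⟩
      · exact ⟨hq, right_mem_lineThrough _ _⟩
    have := Set.ncard_le_ncard hsub (hfin.inter_of_left _)
    rw [Set.ncard_pair hpq] at this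
    omega
  constructor
  · intro hL
    have h2 := hL.2
    obtain ⟨p, q, hp, hq, hpq⟩ := (Set.one_lt_ncard_iff (hfin.inter_of_left L)).mp (by omega)
    have hLpq := hL.1.eq_lineThrough hpq hp.2 hq.2
    have hsymm : ∀ x y : ℙ ℂ (Fin (n + 1) → ℂ), lineThrough x y = lineThrough y x := fun x y => by
      rw [lineThrough, lineThrough, sup_comm]
    rcases hp.1 with rfl | rfl | rfl <;> rcases hq.1 with rfl | rfl | rfl <;>
      simp_all
  · rintro (rfl | rfl | rfl)
    · exact key _ _ hab (by simp) (by simp)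
    · exact key _ _ hac (by simp) (by simp)
    · exact key _ _ hbc (by simp) (by simp)

theorem baseLocus_three (hn : 2 ≤ n) :
    baseLocus 3 (veroneseVariety n 3) = smoothSets 3 (veroneseVariety n 3) := by
  refine Set.Subset.antisymm (fun S hS => hS.1) fun S hS => ⟨hS, ?_⟩
  obtain ⟨A, hA, rfl⟩ := exists_image_veronese_of_mem_smoothSets three_ne_zero hS
  have hfin := Set.finite_of_encard_eq_coe hA
  obtain ⟨a, b, c, hab, hac, hbc, rfl⟩ := Set.encard_eq_three.mp hA
  constructor
  -- One hyperplane through each side of the triangle: every vertex lies on two of them. Collinear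
  -- points need no separate treatment.
  · obtain ⟨l, hl, hl0⟩ := exists_dual_of_isLine hn (isLine_lineThrough hab)
    obtain ⟨m, hm, hm0⟩ := exists_dual_of_isLine hn (isLine_lineThrough hac)
    obtain ⟨k, hk, hk0⟩ := exists_dual_of_isLine hn (isLine_lineThrough hbc)
    refine tangentSpan_ne_top_of_linearForms three_ne_zero ![l, m, k] ?_ ?_
    · intro i
      fin_cases i <;> assumption
    · rintro x (rfl | rfl | rfl)
      · exact ⟨0, 1, by decide, hl0 _ (left_mem_lineThrough _ _), hm0 _ (left_mem_lineThrough _ _)⟩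
      · exact ⟨0, 2, by decide, hl0 _ (right_mem_lineThrough _ _), hk0 _ (left_mem_lineThrough _ _)⟩
      · exact ⟨1, 2, by decide, hm0 _ (right_mem_lineThrough _ _),
          hk0 _ (right_mem_lineThrough _ _)⟩
  · rw [extraPoints_veronese three_ne_zero, Set.image_nonempty]
    obtain ⟨p, hp⟩ := ((infinite_lineThrough hab).sdiff hfin).nonempty
    exact ⟨p, ((heavyLine_iff_of_three hab hac hbc).mpr (Or.inl rfl)).subset_singularBase
      three_ne_zero hfin hp.1, hp.2⟩

theorem extraPoints_three_of_not_collinear (hA : A.encard = 3)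
    (h : ¬ ∃ L : Set (ℙ ℂ (Fin (n + 1) → ℂ)), IsLine L ∧ A ⊆ L) :
    ∃ L R T : Set (ℙ ℂ (Fin (n + 1) → ℂ)), IsLine L ∧ IsLine R ∧ IsLine T ∧
      L ≠ R ∧ L ≠ T ∧ R ≠ T ∧
      (A ∩ L).encard = 2 ∧ (A ∩ R).encard = 2 ∧ (A ∩ T).encard = 2 ∧
      extraPoints (veroneseVariety n 3) (veronese n 3 '' A) ∪ veronese n 3 '' A =
        veronese n 3 '' (L ∪ R ∪ T) := by
  obtain ⟨a, b, c, hab, hac, hbc, rfl⟩ := Set.encard_eq_three.mp hA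
  have hnot : ∀ p q, p ≠ q → ¬ ({a, b, c} ⊆ lineThrough p q) := fun p q hpq hsub =>
    h ⟨_, isLine_lineThrough hpq, hsub⟩
  have haab := left_mem_lineThrough a b
  have hbab := right_mem_lineThrough a b
  have haac := left_mem_lineThrough a c
  have hcac := right_mem_lineThrough a c
  have hbbc := left_mem_lineThrough b c
  have hcbc := right_mem_lineThrough b c
  have hc : c ∉ lineThrough a b := fun hc => hnot a b hab (by
    rintro x (rfl | rfl | rfl) <;> assumption)
  have hb : b ∉ lineThrough a c := fun hb => hnot a c hac (by
    rintro x (rfl | rfl | rfl) <;> assumption)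
  have ha : a ∉ lineThrough b c := fun ha => hnot b c hbc (by
    rintro x (rfl | rfl | rfl) <;> assumption)
  refine ⟨lineThrough a b, lineThrough a c, lineThrough b c, isLine_lineThrough hab,
    isLine_lineThrough hac, isLine_lineThrough hbc, fun h => hc (h ▸ hcac), fun h => hc (h ▸ hcbc),
    fun h => hb (h ▸ hbbc), ?_, ?_, ?_, ?_⟩
  · rw [← Set.encard_pair hab]
    congr 1
    ext x
    constructor
    · rintro ⟨rfl | rfl | rfl, hx⟩ <;> simp_all
    · rintro (rfl | rfl) <;> simp_all
  · rw [← Set.encard_pair hac]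
    congr 1
    ext x
    constructor
    · rintro ⟨rfl | rfl | rfl, hx⟩ <;> simp_all
    · rintro (rfl | rfl) <;> simp_all
  · rw [← Set.encard_pair hbc]
    congr 1
    ext x
    constructor
    · rintro ⟨rfl | rfl | rfl, hx⟩ <;> simp_all
    · rintro (rfl | rfl) <;> simp_all
  · rw [extraPoints_eq_of_forall_heavyLine (S := lineThrough a b ∪ lineThrough a c ∪ lineThrough b c)
      (Nat.le_succ 2) le_rfl hA, ← Set.image_union, Set.sdiff_union_of_subset]
    · rintro x (rfl | rfl | rfl) <;> simp_all
    · intro x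
      simp only [heavyLine_iff_of_three hab hac hbc, Set.mem_union]
      constructor
      · rintro ⟨L, rfl | rfl | rfl, hx⟩ <;> simp [hx]
      · rintro ((hx | hx) | hx)
        · exact ⟨_, Or.inl rfl, hx⟩
        · exact ⟨_, Or.inr (Or.inl rfl), hx⟩
        · exact ⟨_, Or.inr (Or.inr rfl), hx⟩

theorem extraPoints_three_of_collinear (hA : A.encard = 3) (hL : IsLine L) (hAL : A ⊆ L) :
    extraPoints (veroneseVariety n 3) (veronese n 3 '' A) = veronese n 3 '' (L \ A) := by
  have hcard : A.ncard = 3 := by rw [Set.ncard, hA]; rfl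
  have hfin : A.Finite := Set.finite_of_ncard_ne_zero (by omega)
  refine extraPoints_of_unique_heavyLine (r := 3) (by omega) le_rfl hA
    ⟨hL, by rw [Set.inter_eq_left.mpr hAL, hcard]; omega⟩ fun R hR => ?_
  have h2 := hR.2
  obtain ⟨p, q, hp, hq, hpq⟩ := (Set.one_lt_ncard_iff (hfin.inter_of_left R)).mp (by omega)
  rw [hR.1.eq_lineThrough hpq hp.2 hq.2, hL.eq_lineThrough hpq (hAL hp.1) (hAL hq.1)]

end BaseLocus

end

/-! ### The main theorem -/

theorem mainTheorem1 (n d : ℕ) (hn : 2 ≤ n) (hd : 2 ≤ d) :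
    -- nonemptiness of the base loci
    (∀ r : ℕ, (BaseLocus.baseLocus r (BaseLocus.veroneseVariety n d)).Nonempty ↔
      d + 1 ≤ 2 * r) ∧
    -- the description of `B(ν_d(A))` for `⌈(d+1)/2⌉ ≤ r ≤ d`, away from `r = d = 3`
    (∀ r : ℕ, ⌈((d : ℚ) + 1) / 2⌉₊ ≤ r → r ≤ d →
      ∀ A : Set (ℙ ℂ (Fin (n + 1) → ℂ)), A.encard = r →
        BaseLocus.veronese n d '' A ∈
          BaseLocus.baseLocus r (BaseLocus.veroneseVariety n d) →
        (r = d → 5 ≤ d → Odd d →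
          (∃ L : Set (ℙ ℂ (Fin (n + 1) → ℂ)), BaseLocus.IsLine L ∧
            (((d + 1) / 2 : ℕ) : ℕ∞) ≤ (A ∩ L).encard ∧
            BaseLocus.extraPoints (BaseLocus.veroneseVariety n d) (BaseLocus.veronese n d '' A) =
              BaseLocus.veronese n d '' (L \ A)) ∨
          (∃ L R : Set (ℙ ℂ (Fin (n + 1) → ℂ)), BaseLocus.IsLine L ∧ BaseLocus.IsLine R ∧ L ≠ R ∧
            (∃ p ∈ A, L ∩ R = {p}) ∧
            (A ∩ L).encard = (((d + 1) / 2 : ℕ) : ℕ∞) ∧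
            (A ∩ R).encard = (((d + 1) / 2 : ℕ) : ℕ∞) ∧
            BaseLocus.extraPoints (BaseLocus.veroneseVariety n d) (BaseLocus.veronese n d '' A) =
              BaseLocus.veronese n d '' ((L ∪ R) \ A))) ∧
        (r < d ∨ (r = d ∧ Even d) →
          ∃ L : Set (ℙ ℂ (Fin (n + 1) → ℂ)), BaseLocus.IsLine L ∧
            (⌈((d : ℚ) + 1) / 2⌉₊ : ℕ∞) ≤ (A ∩ L).encard ∧
            BaseLocus.extraPoints (BaseLocus.veroneseVariety n d) (BaseLocus.veronese n d '' A) =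
              BaseLocus.veronese n d '' (L \ A))) ∧
    -- the case `r = d = 3`
    (d = 3 →
      BaseLocus.baseLocus 3 (BaseLocus.veroneseVariety n d) =
        BaseLocus.smoothSets 3 (BaseLocus.veroneseVariety n d) ∧
      ∀ A : Set (ℙ ℂ (Fin (n + 1) → ℂ)), A.encard = 3 →
        ((¬ ∃ L : Set (ℙ ℂ (Fin (n + 1) → ℂ)), BaseLocus.IsLine L ∧ A ⊆ L) →
          ∃ L R T : Set (ℙ ℂ (Fin (n + 1) → ℂ)),
            BaseLocus.IsLine L ∧ BaseLocus.IsLine R ∧ BaseLocus.IsLine T ∧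
            L ≠ R ∧ L ≠ T ∧ R ≠ T ∧
            (A ∩ L).encard = 2 ∧ (A ∩ R).encard = 2 ∧ (A ∩ T).encard = 2 ∧
            BaseLocus.extraPoints (BaseLocus.veroneseVariety n d) (BaseLocus.veronese n d '' A) ∪
                BaseLocus.veronese n d '' A =
              BaseLocus.veronese n d '' (L ∪ R ∪ T)) ∧
        (∀ L : Set (ℙ ℂ (Fin (n + 1) → ℂ)), BaseLocus.IsLine L → A ⊆ L →
          BaseLocus.extraPoints (BaseLocus.veroneseVariety n d) (BaseLocus.veronese n d '' A) =
            BaseLocus.veronese n d '' (L \ A))) := by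

  refine ⟨BaseLocus.baseLocus_nonempty_iff hn hd, ?_, ?_⟩
  · intro r _ hrd A hA hmem
    have hfin := Set.finite_of_encard_eq_coe hA
    have hcast : ∀ L : Set (ℙ ℂ (Fin (n + 1) → ℂ)), ((A ∩ L).ncard : ℕ∞) = (A ∩ L).encard :=
      fun L => (hfin.inter_of_left L).cast_ncard_eq
    obtain ⟨L, hL⟩ := BaseLocus.exists_heavyLine_of_mem_baseLocus hd hrd hA hmem
    constructor
    · rintro rfl h5 hodd
      by_cases huniq : ∀ R, BaseLocus.IsHeavyLine r A R → R = L
      · refine Or.inl ⟨L, hL.1, ?_,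
          BaseLocus.extraPoints_of_unique_heavyLine hd hrd hA hL huniq⟩
        have h2 := hL.2
        rw [← hcast, Nat.cast_le]
        omega
      · push Not at huniq
        obtain ⟨R, hR, hne⟩ := huniq
        obtain ⟨hp, hcL, hcR, -⟩ := hL.of_ne hA hodd hR hne.symm
        refine Or.inr ⟨L, R, hL.1, hR.1, hne.symm, hp, ?_, ?_, ?_⟩
        · rw [← hcast, hcL]
        · rw [← hcast, hcR]
        · refine BaseLocus.extraPoints_eq_of_forall_heavyLine hd hrd hA fun b => ⟨?_, ?_⟩
          · rintro ⟨T, hT, hb⟩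
            rcases hL.eq_or_eq h5 hA hodd hR hne.symm hT with rfl | rfl
            · exact Or.inl hb
            · exact Or.inr hb
          · rintro (hb | hb)
            · exact ⟨L, hL, hb⟩
            · exact ⟨R, hR, hb⟩
    · intro hr
      refine ⟨L, hL.1, ?_, BaseLocus.extraPoints_of_unique_heavyLine hd hrd hA hL
        fun R hR => hR.eq_of_lt hA hr hL⟩
      rw [← hcast, Nat.cast_le, BaseLocus.ceil_half_le_iff]
      exact hL.2
  · rintro rfl
    exact ⟨BaseLocus.baseLocus_three hn, fun A hA =>
      ⟨BaseLocus.extraPoints_three_of_not_collinear hA,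
        fun L hL hAL => BaseLocus.extraPoints_three_of_collinear hA hL hAL⟩⟩
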